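/- A quasigroup is a set $Q$ with a binary operation $\cdot$ such that for all $a,b\in Q$ each of the equations $a\cdot x=b$ and $y\cdot a=b$ has exactly one solution. It is called pentagonal if for all $x,y,z,u\in Q$ $$x\cdot x=x,\qquad (x\cdot y)\cdot(z\cdot u)=(x\cdot z)\cdot(y\cdot u),\qquad (((x\cdot y)\cdot x)\cdot y)\cdot x=y .$$ An abelian group $(Q,+)$ induces the pentagonal quasigroup $(Q,\cdot)$ if there is an automorphism $\varphi$ of $(Q,+)$ that is regular (i.e. $\varphi(x)=x$ only for $x=0$), satisfies $\varphi^4-\varphi^3+\varphi^2-\varphi+\varepsilon=0$, where $\varepsilon$ is the identity map, and is such that $x\cdot y=\varphi(x)+y-\varphi(y)$ for all $x,y\in Q$. **Theorem 5.1.** Let $G$ be an abelian group of order $n$ with $1<n<100$. Then $G$ induces a pentagonal quasigroup if and only if $G$ is isomorphic to one of the groups $$\mathbb{Z}_{5},\ \mathbb{Z}_{11},\ \mathbb{Z}_{2}^4,\ \mathbb{Z}_{5}^2,\ \mathbb{Z}_{31},\ \mathbb{Z}_{41},\ \mathbb{Z}_{55},\ \mathbb{Z}_{61},\ \mathbb{Z}_{71},\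 \mathbb{Z}_{2}^4\times\mathbb{Z}_{5},\ \mathbb{Z}_{3}^4 .$$ -/

import Mathlib

/-- A binary operation on `Q` is a quasigroup: for all `a b`, each of the equations
`a · x = b` and `y · a = b` has exactly one solution. -/
def IsQuasigroup {Q : Type*} (op : Q → Q → Q) : Prop :=
  ∀ a b : Q, (∃! x, op a x = b) ∧ (∃! y, op y a = b)

/-- A pentagonal quasigroup: an idempotent, medial quasigroup satisfying the pentagonal identity
`((xy · x)y) · x = y`. -/
structure IsPentagonalQuasigroup {Q : Type*} (op : Q → Q → Q) : Prop where
  quasigroup : IsQuasigroup op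
  idempotent : ∀ x, op x x = x
  medial : ∀ x y z u, op (op x y) (op z u) = op (op x z) (op y u)
  pentagonal : ∀ x y, op (op (op (op x y) x) y) x = y

/-- An automorphism of an additive group is regular if it fixes only `0`. -/
def IsRegularAut {G : Type*} [AddCommGroup G] (φ : G ≃+ G) : Prop :=
  ∀ x, φ x = x ↔ x = 0

/-- The abelian group `G` induces the groupoid `(G, op)`: there is a regular automorphism `φ`
of `G` with `φ⁴ - φ³ + φ² - φ + ε = 0` and `x · y = φ(x) + y - φ(y)`. -/
def Induces (G : Type*) [AddCommGroup G] (op : G → G → G) : Prop :=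
  ∃ φ : G ≃+ G, IsRegularAut φ ∧
    (∀ x, φ (φ (φ (φ x))) - φ (φ (φ x)) + φ (φ x) - φ x + x = 0) ∧
    ∀ x y, op x y = φ x + y - φ y

/-- The abelian group `G` induces some pentagonal quasigroup (on its underlying set). -/
def InducesPentagonalQuasigroup (G : Type*) [AddCommGroup G] : Prop :=
  ∃ op : G → G → G, IsPentagonalQuasigroup op ∧ Induces G op

/-! Everything reduces to an endomorphism `φ` with Φ₁₀(φ) = 0: invertibility, regularity and the
quasigroup laws follow from that relation. Since X⁵ + 1 = (X + 1)Φ₁₀, the map -φ has fifth power 1,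
and its fixed points are killed by Φ₁₀(-1) = 5. So if 5 ∤ |G|, counting orbits gives |G| ≡ 1 mod 5
(`card_mod_five`). Kernels of multiplication by integers inherit `φ`, so every coprime factor of |G|
prime to 5 is 1 mod 5, which leaves eleven orders (`card_cases`). The same count on the p-torsion
settles orders 16 and 81; for 25, Φ₁₀ has no root mod 25. Conversely, roots of Φ₁₀ and its companion
matrix supply `φ`. -/

/-- `G` carries an endomorphism annihilated by the tenth cyclotomic polynomial. -/
def HasTenthCyclotomicEnd (G : Type*) [AddCommGroup G] : Prop :=
  ∃ φ : G →+ G, ∀ x, φ (φ (φ (φ x))) - φ (φ (φ x)) + φ (φ x) - φ x + x = 0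

theorem InducesPentagonalQuasigroup.hasTenthCyclotomicEnd {G : Type*} [AddCommGroup G]
    (h : InducesPentagonalQuasigroup G) : HasTenthCyclotomicEnd G := by
  obtain ⟨_, _, φ, _, hφ, _⟩ := h
  exact ⟨φ.toAddMonoidHom, hφ⟩

/-! ### Endomorphisms annihilated by Φ₁₀ -/

namespace HasTenthCyclotomicEnd

theorem inducesPentagonalQuasigroup {G : Type*} [AddCommGroup G]
    (h : HasTenthCyclotomicEnd G) : InducesPentagonalQuasigroup G := by
  obtain ⟨φ, hφ⟩ := h
  let e : G ≃+ G :=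
    { toFun := φ
      invFun := fun x => -φ (φ (φ x)) + φ (φ x) - φ x + x
      left_inv := fun x => by
        have := hφ x
        simp only
        rw [← sub_eq_zero, ← neg_eq_zero, ← this]
        abel
      right_inv := fun x => by
        have := hφ x
        simp only [map_add, map_sub, map_neg]
        rw [← sub_eq_zero, ← neg_eq_zero, ← this]
        abel
      map_add' := φ.map_add }
  have he : ∀ x, e x = φ x := fun _ => rfl
  have fixed : ∀ x, φ x = x → x = 0 := fun x hx => by
    have := hφ x
    simpa [hx] using this
  refine ⟨fun x y => φ x + y - φ y, ⟨fun a b => ⟨?_, ?_⟩, ?_, ?_, ?_⟩, e,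
    fun x => ⟨fixed x, fun hx => by rw [hx, map_zero]⟩, hφ, fun _ _ => rfl⟩
  -- The equation reads (1 - φ)x = b - φ(a), and (1 - φ)(φ³ + φ) = 1 - Φ₁₀(φ) = 1.
  · refine ⟨φ (φ (φ (b - φ a))) + φ (b - φ a), ?_, fun y hy => ?_⟩
    · have := hφ (b - φ a)
      simp only [map_add, map_sub] at this ⊢
      rw [← sub_eq_zero, ← neg_eq_zero, ← this]
      abel
    · have := hφ y
      rw [← hy]
      simp only [map_add, map_sub]
      rw [← sub_eq_zero, ← this]
      abel
  · refine ⟨e.symm (b - a + φ a), ?_, fun y hy => ?_⟩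
    · have : φ (e.symm (b - a + φ a)) = b - a + φ a := e.apply_symm_apply _
      simp only [this]
      abel
    · rw [AddEquiv.eq_symm_apply, he, ← hy]
      abel
  · intro x; abel
  · intro x y z u
    simp only [map_add, map_sub]
    abel
  · intro x y
    have hx := hφ x
    have hy := hφ y
    -- The two sides of the pentagonal identity differ by exactly Φ₁₀(φ)(x) - Φ₁₀(φ)(y).
    have hxy := sub_eq_zero.2 (hx.trans hy.symm)
    simp only [map_add, map_sub]
    rw [← sub_eq_zero, ← hxy]
    abel

theorem of_addEquiv {G H : Type*} [AddCommGroup G] [AddCommGroup H] (e : G ≃+ H)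
    (h : HasTenthCyclotomicEnd H) : HasTenthCyclotomicEnd G := by
  obtain ⟨φ, hφ⟩ := h
  refine ⟨(e.symm.toAddMonoidHom.comp φ).comp e.toAddMonoidHom, fun x => e.injective ?_⟩
  simpa using hφ (e x)

theorem prod {G H : Type*} [AddCommGroup G] [AddCommGroup H]
    (hG : HasTenthCyclotomicEnd G) (hH : HasTenthCyclotomicEnd H) :
    HasTenthCyclotomicEnd (G × H) := by
  obtain ⟨φ, hφ⟩ := hG
  obtain ⟨ψ, hψ⟩ := hH
  exact ⟨φ.prodMap ψ, fun x => Prod.ext (hφ x.1) (hψ x.2)⟩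

theorem pi {ι G : Type*} [AddCommGroup G] (hG : HasTenthCyclotomicEnd G) :
    HasTenthCyclotomicEnd (ι → G) := by
  obtain ⟨φ, hφ⟩ := hG
  exact ⟨φ.compLeft ι, fun x => funext fun i => hφ (x i)⟩

theorem of_root {R : Type*} [CommRing R] (a : R) (ha : a ^ 4 - a ^ 3 + a ^ 2 - a + 1 = 0) :
    HasTenthCyclotomicEnd R :=
  ⟨AddMonoidHom.mulLeft a, fun x => by
    simp only [AddMonoidHom.coe_mulLeft]
    linear_combination x * ha⟩

/-- Multiplication by `X` on `R[X]/(X⁴ - X³ + X² - X + 1)`. -/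
theorem fin_four (R : Type*) [CommRing R] : HasTenthCyclotomicEnd (Fin 4 → R) := by
  refine ⟨⟨⟨fun v => ![-v 3, v 0 + v 3, v 1 - v 3, v 2 + v 3], ?_⟩, ?_⟩, fun v => ?_⟩
  · ext i; fin_cases i <;> simp
  · intro v w
    ext i; fin_cases i <;> simp <;> ring
  · ext i; fin_cases i <;> simp <;> ring

theorem ker_nsmul {G : Type*} [AddCommGroup G] (h : HasTenthCyclotomicEnd G) (m : ℕ) :
    HasTenthCyclotomicEnd (nsmulAddMonoidHom (α := G) m).ker := by
  obtain ⟨φ, hφ⟩ := h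
  refine ⟨(φ.comp (nsmulAddMonoidHom (α := G) m).ker.subtype).codRestrict _ fun x => ?_,
    fun x => Subtype.ext (hφ x)⟩
  have hx : m • (x : G) = 0 := x.2
  show m • φ x = 0
  rw [← map_nsmul, hx, map_zero]

theorem card_mod_five {G : Type*} [AddCommGroup G] [Finite G] (h : HasTenthCyclotomicEnd G)
    (h5 : ¬ 5 ∣ Nat.card G) : Nat.card G % 5 = 1 := by
  classical
  have := Fintype.ofFinite G
  obtain ⟨φ, hφ⟩ := h
  have pow5 : ∀ x, φ (φ (φ (φ (φ x)))) = -x := fun x => by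
    have h1 := hφ x
    have h2 := hφ (φ x)
    rw [← sub_eq_zero, ← add_zero (0 : G)]
    nth_rewrite 1 [← h1]
    rw [← h2]
    abel
  let f : Function.End G := fun x => -φ x
  have hf : f ^ 5 ^ 1 = 1 := by
    funext x
    show f (f (f (f (f x)))) = x
    simp only [f, map_neg, pow5, neg_neg]
  have : Fact (Nat.Prime 5) := ⟨by norm_num⟩
  have key := Equiv.Perm.card_fixedPoints_modEq hf
  have fixed : ∀ x : Function.fixedPoints f, (x : G) = 0 := fun ⟨x, hx⟩ => by
    have hx' : φ x = -x := by rw [← neg_eq_iff_eq_neg]; exact hx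
    have h1 := hφ x
    simp only [hx', map_neg, neg_neg, sub_neg_eq_add] at h1
    have h5x : 5 • x = 0 := by rw [← h1]; abel
    have := addOrderOf_dvd_of_nsmul_eq_zero h5x
    rcases (Nat.dvd_prime (by norm_num)).1 this with h | h
    · exact AddMonoid.addOrderOf_eq_one_iff.1 h
    · exact absurd (h ▸ addOrderOf_dvd_natCard x) h5
  have : Subsingleton (Function.fixedPoints f) :=
    ⟨fun a b => Subtype.ext ((fixed a).trans (fixed b).symm)⟩
  have : Nonempty (Function.fixedPoints f) := ⟨⟨0, by simp [f, Function.IsFixedPt]⟩⟩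
  rw [← Nat.card_eq_fintype_card, ← Nat.card_eq_fintype_card,
    Nat.card_unique (α := Function.fixedPoints f)] at key
  exact key

end HasTenthCyclotomicEnd

/-! ### Coprime splitting and elementary abelian groups -/

section Splitting

variable {G : Type*} [AddCommGroup G]

theorem nonempty_addEquiv_ker_nsmul_prod {a b : ℕ} (hab : a.Coprime b)
    (h : ∀ x : G, (a * b) • x = 0) :
    Nonempty (G ≃+ (nsmulAddMonoidHom (α := G) a).ker × (nsmulAddMonoidHom (α := G) b).ker) := by
  have bezout : (a.gcdA b : ℤ) * a + a.gcdB b * b = 1 := by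
    have := Nat.gcd_eq_gcd_ab a b
    rw [hab.gcd_eq_one] at this
    push_cast at this
    linarith
  let f : (nsmulAddMonoidHom (α := G) a).ker × (nsmulAddMonoidHom (α := G) b).ker →+ G :=
    (nsmulAddMonoidHom (α := G) a).ker.subtype.coprod (nsmulAddMonoidHom (α := G) b).ker.subtype
  refine ⟨(AddEquiv.ofBijective f ⟨?_, fun x => ?_⟩).symm⟩
  · rw [injective_iff_map_eq_zero]
    rintro ⟨⟨x, hx⟩, ⟨y, hy⟩⟩ hxy
    replace hxy : x + y = 0 := hxy
    replace hx : a • x = 0 := hx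
    replace hy : b • y = 0 := hy
    have hy' : b • x = 0 := by rw [eq_neg_of_add_eq_zero_left hxy, smul_neg, hy, neg_zero]
    have hx0 : x = 0 := by
      rw [← one_zsmul x, ← bezout, add_smul, mul_smul, mul_smul, natCast_zsmul, natCast_zsmul,
        hx, hy', smul_zero, smul_zero, add_zero]
    have hy0 : y = 0 := by simpa [hx0] using hxy
    subst hx0 hy0
    rfl
  · refine ⟨⟨⟨(a.gcdB b * b : ℤ) • x, ?_⟩, ⟨(a.gcdA b * a : ℤ) • x, ?_⟩⟩, ?_⟩
    · show a • (a.gcdB b * b : ℤ) • x = 0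
      rw [← natCast_zsmul, ← mul_smul, mul_left_comm, mul_smul, ← Nat.cast_mul, natCast_zsmul, h,
        smul_zero]
    · show b • (a.gcdA b * a : ℤ) • x = 0
      rw [← natCast_zsmul, ← mul_smul, mul_left_comm, mul_smul, ← Nat.cast_mul, natCast_zsmul,
        mul_comm b, h, smul_zero]
    · show (a.gcdB b * b : ℤ) • x + (a.gcdA b * a : ℤ) • x = x
      rw [← add_smul, add_comm, bezout, one_smul]

theorem coprime_card_ker_nsmul [Finite G] {a b : ℕ} (hab : a.Coprime b) :
    (Nat.card (nsmulAddMonoidHom (α := G) a).ker).Coprime b := by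
  refine Nat.Coprime.symm (Nat.coprime_of_dvd fun p hp hpb hpc => ?_)
  have := Fact.mk hp
  obtain ⟨⟨x, hx⟩, hxo⟩ := exists_prime_addOrderOf_dvd_card' p hpc
  rw [AddSubgroup.addOrderOf_mk] at hxo
  have hpa : p ∣ a := hxo ▸ addOrderOf_dvd_of_nsmul_eq_zero hx
  exact hp.one_lt.ne' (Nat.dvd_one.1 (hab.gcd_eq_one ▸ Nat.dvd_gcd hpa hpb))

/-- The two kernels have orders with product ab, and by Cauchy's theorem each order is coprime to
the opposite factor. -/
theorem card_ker_nsmul [Finite G] {a b : ℕ} (hab : a.Coprime b) (h : Nat.card G = a * b) :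
    Nat.card (nsmulAddMonoidHom (α := G) a).ker = a := by
  obtain ⟨e⟩ := nonempty_addEquiv_ker_nsmul_prod (G := G) hab fun x => h ▸ card_nsmul_eq_zero'
  have hc := (Nat.card_congr e.toEquiv).symm.trans h
  rw [Nat.card_prod] at hc
  refine Nat.dvd_antisymm
    ((coprime_card_ker_nsmul hab).dvd_of_dvd_mul_right (Dvd.intro _ hc)) ?_
  exact (coprime_card_ker_nsmul hab.symm).symm.dvd_of_dvd_mul_right (Dvd.intro _ hc.symm)

theorem nonempty_addEquiv_zmod_of_prime_card {p : ℕ} (hp : p.Prime) (h : Nat.card G = p) :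
    Nonempty (G ≃+ ZMod p) := by
  have := Fact.mk hp
  subst h
  exact ⟨(zmodAddCyclicAddEquiv (isAddCyclic_of_prime_card rfl)).symm⟩

theorem nonempty_addEquiv_pi_zmod_of_module {p k : ℕ} [Fact p.Prime] [Finite G]
    [Module (ZMod p) G] (h : Nat.card G = p ^ k) : Nonempty (G ≃+ (Fin k → ZMod p)) := by
  have hk : Module.finrank (ZMod p) G = k := by
    have := Module.natCard_eq_pow_finrank (K := ZMod p) (V := G)
    rw [h, Nat.card_zmod] at this
    exact (Nat.pow_right_injective (Fact.out : p.Prime).two_le this).symm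
  have e : G ≃ₗ[ZMod p] (Fin k → ZMod p) := LinearEquiv.ofFinrankEq _ _ (by simpa using hk)
  exact ⟨e.toAddEquiv⟩

theorem nonempty_addEquiv_pi_zmod {p k : ℕ} (hp : p.Prime) (h : Nat.card G = p ^ k)
    (h0 : ∀ x : G, p • x = 0) : Nonempty (G ≃+ (Fin k → ZMod p)) := by
  have := Fact.mk hp
  have : Finite G := Nat.finite_of_card_ne_zero (h ▸ (pow_pos hp.pos k).ne')
  have := AddCommGroup.zmodModule h0
  exact nonempty_addEquiv_pi_zmod_of_module h

end Splitting

/-! ### Constraints on the order and structure -/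

namespace HasTenthCyclotomicEnd

variable {G : Type*} [AddCommGroup G]

theorem mod_five_of_card_eq_mul [Finite G] (h : HasTenthCyclotomicEnd G) {a b : ℕ}
    (hab : a.Coprime b) (hc : Nat.card G = a * b) (h5 : ¬ 5 ∣ a) : a % 5 = 1 := by
  have hk := card_ker_nsmul hab hc
  exact hk ▸ (h.ker_nsmul a).card_mod_five (by rwa [hk])

/-- The hypothesis on `p` says that `p` has order `4` modulo `5`. -/
theorem nonempty_addEquiv_fin_four (h : HasTenthCyclotomicEnd G) {p : ℕ} (hp : p.Prime)
    (hp1 : p % 5 = 2 ∨ p % 5 = 3) (hc : Nat.card G = p ^ 4) :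
    Nonempty (G ≃+ (Fin 4 → ZMod p)) := by
  have := Fact.mk hp
  have : Finite G := Nat.finite_of_card_ne_zero (hc ▸ (pow_pos hp.pos 4).ne')
  set K := (nsmulAddMonoidHom (α := G) p).ker
  have hKdvd : Nat.card K ∣ p ^ 4 := hc ▸ K.card_addSubgroup_dvd_card
  obtain ⟨k, hk4, hk⟩ := (Nat.dvd_prime_pow hp).1 hKdvd
  have hp5 : ¬ 5 ∣ p := by omega
  have hmod : p ^ k % 5 = 1 := by
    rw [← hk]
    refine (h.ker_nsmul p).card_mod_five ?_
    rw [show Nat.card _ = _ from hk]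
    exact fun h5 => hp5 (Nat.Prime.dvd_of_dvd_pow (by norm_num) h5)
  have hk0 : k ≠ 0 := by
    rintro rfl
    obtain ⟨x, hx⟩ := exists_prime_addOrderOf_dvd_card' (G := G) p (hc ▸ dvd_pow_self p (by norm_num))
    have hxK : x ∈ K := show p • x = 0 from hx ▸ addOrderOf_nsmul_eq_zero x
    have hsub := (Nat.card_eq_one_iff_unique.1 (hk.trans (pow_zero p))).1
    have hx0 : x = 0 := congrArg Subtype.val (Subsingleton.elim (⟨x, hxK⟩ : K) 0)
    rw [hx0, addOrderOf_zero] at hx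
    exact hp.one_lt.ne hx
  -- Since p has order 4 modulo 5, 4 ∣ k, while 0 < k ≤ 4.
  have hk' : k = 4 := by
    rw [Nat.pow_mod] at hmod
    rcases hp1 with h1 | h1 <;> rw [h1] at hmod <;> interval_cases k <;> simp_all
  have htop : K = ⊤ := AddSubgroup.eq_top_of_card_eq K (by rw [hk, hc, hk'])
  exact nonempty_addEquiv_pi_zmod hp hc fun x => (htop ▸ AddSubgroup.mem_top x : x ∈ K)

theorem nonempty_addEquiv_of_card_twenty_five (h : HasTenthCyclotomicEnd G)
    (hc : Nat.card G = 25) : Nonempty (G ≃+ (Fin 2 → ZMod 5)) := by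
  have : Finite G := Nat.finite_of_card_ne_zero (by omega)
  refine nonempty_addEquiv_pi_zmod (by norm_num) hc fun x => ?_
  have hd : addOrderOf x ∣ 5 ^ 2 := by simpa [hc] using addOrderOf_dvd_natCard x
  obtain ⟨k, hk, hx⟩ := (Nat.dvd_prime_pow (by norm_num)).1 hd
  obtain hk1 | rfl : k ≤ 1 ∨ k = 2 := by omega
  · exact addOrderOf_dvd_iff_nsmul_eq_zero.1 (hx ▸ pow_dvd_pow 5 hk1)
  exfalso
  -- An element of order 25 would make `φ` multiplication by a root a of Φ₁₀ mod 25. But a ≡ -1 mod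
  -- 5 is forced, and then Φ₁₀(a) ≡ 5 mod 25.
  have hcyc : IsAddCyclic G := isAddCyclic_of_addOrderOf_eq_card x (by rw [hx, hc]; norm_num)
  have e : ZMod 25 ≃+ G := hc ▸ zmodAddCyclicAddEquiv hcyc
  obtain ⟨φ, hφ⟩ := h.of_addEquiv e
  have hmul : ∀ y, φ y = y * φ 1 := fun y => by
    obtain ⟨n, rfl⟩ := ZMod.natCast_zmod_surjective y
    rw [← nsmul_one, map_nsmul, nsmul_eq_mul, nsmul_one]
  have h1 := hφ 1
  rw [hmul (φ (φ (φ 1))), hmul (φ (φ 1)), hmul (φ 1)] at h1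
  generalize φ 1 = a at h1
  clear hmul hφ
  revert a
  decide

end HasTenthCyclotomicEnd

theorem card_cases {n : ℕ} (h1 : 1 < n) (h100 : n < 100)
    (h : ∀ a b : ℕ, a.Coprime b → n = a * b → ¬ 5 ∣ a → a % 5 = 1) :
    n = 5 ∨ n = 11 ∨ n = 16 ∨ n = 25 ∨ n = 31 ∨ n = 41 ∨ n = 55 ∨ n = 61 ∨ n = 71 ∨ n = 80 ∨
      n = 81 := by
  -- Replacing b by m / a makes the condition a finite check.
  have key : ∀ m ∈ Finset.range 100, 1 < m →
      (∀ a ∈ Finset.range (m + 1), a.gcd (m / a) = 1 → m = a * (m / a) → ¬ 5 ∣ a → a % 5 = 1) →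
      m ∈ [5, 11, 16, 25, 31, 41, 55, 61, 71, 80, 81] := by
    decide +kernel
  simpa using key n (Finset.mem_range.2 h100) h1 fun a _ hab hn => h a (n / a) hab hn

theorem theorem5p1 {G : Type*} [AddCommGroup G]
    (h1 : 1 < Nat.card G) (h100 : Nat.card G < 100) :
    InducesPentagonalQuasigroup G ↔
      Nonempty (G ≃+ ZMod 5) ∨
      Nonempty (G ≃+ ZMod 11) ∨
      Nonempty (G ≃+ (Fin 4 → ZMod 2)) ∨
      Nonempty (G ≃+ (Fin 2 → ZMod 5)) ∨
      Nonempty (G ≃+ ZMod 31) ∨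
      Nonempty (G ≃+ ZMod 41) ∨
      Nonempty (G ≃+ ZMod 55) ∨
      Nonempty (G ≃+ ZMod 61) ∨
      Nonempty (G ≃+ ZMod 71) ∨
      Nonempty (G ≃+ (Fin 4 → ZMod 2) × ZMod 5) ∨
      Nonempty (G ≃+ (Fin 4 → ZMod 3)) := by
  have : Finite G := Nat.finite_of_card_ne_zero (by omega)
  constructor
  · intro hG
    have h := hG.hasTenthCyclotomicEnd
    rcases card_cases h1 h100 (fun a b => h.mod_five_of_card_eq_mul) with
      hc | hc | hc | hc | hc | hc | hc | hc | hc | hc | hc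
    · exact .inl (nonempty_addEquiv_zmod_of_prime_card (by norm_num) hc)
    · exact .inr <| .inl (nonempty_addEquiv_zmod_of_prime_card (by norm_num) hc)
    · exact .inr <| .inr <| .inl (h.nonempty_addEquiv_fin_four (by norm_num) (by norm_num) hc)
    · exact .inr <| .inr <| .inr <| .inl (h.nonempty_addEquiv_of_card_twenty_five hc)
    · exact .inr <| .inr <| .inr <| .inr <| .inl
        (nonempty_addEquiv_zmod_of_prime_card (by norm_num) hc)
    · exact .inr <| .inr <| .inr <| .inr <| .inr <| .inl
        (nonempty_addEquiv_zmod_of_prime_card (by norm_num) hc)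
    · refine .inr <| .inr <| .inr <| .inr <| .inr <| .inr <| .inl ?_
      obtain ⟨e⟩ := nonempty_addEquiv_ker_nsmul_prod (G := G) (a := 5) (b := 11) (by norm_num)
        fun x => by simpa [hc] using card_nsmul_eq_zero' (x := x)
      obtain ⟨e₁⟩ := nonempty_addEquiv_zmod_of_prime_card (by norm_num)
        (card_ker_nsmul (G := G) (a := 5) (b := 11) (by norm_num) hc)
      obtain ⟨e₂⟩ := nonempty_addEquiv_zmod_of_prime_card (by norm_num)
        (card_ker_nsmul (G := G) (a := 11) (b := 5) (by norm_num) hc)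
      exact ⟨(e.trans (e₁.prodCongr e₂)).trans
        (ZMod.chineseRemainder (m := 5) (n := 11) (by norm_num)).symm.toAddEquiv⟩
    · exact .inr <| .inr <| .inr <| .inr <| .inr <| .inr <| .inr <| .inl
        (nonempty_addEquiv_zmod_of_prime_card (by norm_num) hc)
    · exact .inr <| .inr <| .inr <| .inr <| .inr <| .inr <| .inr <| .inr <| .inl
        (nonempty_addEquiv_zmod_of_prime_card (by norm_num) hc)
    · refine .inr <| .inr <| .inr <| .inr <| .inr <| .inr <| .inr <| .inr <| .inr <| .inl ?_
      obtain ⟨e⟩ := nonempty_addEquiv_ker_nsmul_prod (G := G) (a := 16) (b := 5) (by norm_num)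
        fun x => by simpa [hc] using card_nsmul_eq_zero' (x := x)
      obtain ⟨e₁⟩ := (h.ker_nsmul 16).nonempty_addEquiv_fin_four (p := 2) (by norm_num)
        (by norm_num) (card_ker_nsmul (G := G) (a := 16) (b := 5) (by norm_num) hc)
      obtain ⟨e₂⟩ := nonempty_addEquiv_zmod_of_prime_card (by norm_num)
        (card_ker_nsmul (G := G) (a := 5) (b := 16) (by norm_num) hc)
      exact ⟨e.trans (e₁.prodCongr e₂)⟩
    · exact .inr <| .inr <| .inr <| .inr <| .inr <| .inr <| .inr <| .inr <| .inr <| .inr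
        (h.nonempty_addEquiv_fin_four (by norm_num) (by norm_num) hc)
  · open HasTenthCyclotomicEnd in
    rintro (⟨⟨e⟩⟩ | ⟨⟨e⟩⟩ | ⟨⟨e⟩⟩ | ⟨⟨e⟩⟩ | ⟨⟨e⟩⟩ | ⟨⟨e⟩⟩ | ⟨⟨e⟩⟩ | ⟨⟨e⟩⟩ |
        ⟨⟨e⟩⟩ | ⟨⟨e⟩⟩ | ⟨⟨e⟩⟩) <;>
      refine (of_addEquiv e ?_).inducesPentagonalQuasigroup
    -- Modulo 5 the root is -1; modulo the other primes the roots have multiplicative order 10. In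
    -- `ZMod 55`, 19 is 4 mod 5 and 8 mod 11.
    · exact of_root 4 (by decide)
    · exact of_root 2 (by decide)
    · exact fin_four _
    · exact pi (of_root 4 (by decide))
    · exact of_root 15 (by decide)
    · exact of_root 4 (by decide)
    · exact of_root 19 (by decide)
    · exact of_root 3 (by decide)
    · exact of_root 14 (by decide)
    · exact (fin_four _).prod (of_root 4 (by decide))
    · exact fin_four _
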